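/- Let $G\subset GL(p,\mathbb R)$ be a linear Lie group (a closed subgroup), with Lie algebra $\mathfrak g=T_IG\subset M_p(\mathbb R)$; all germs are of class $C^\infty$. Put $$\theta[G]_0(p)=\Big\{\eta:(\mathbb R^p,0)\to(\mathbb R^p,0)\ \Big|\ \Big(\frac{\partial\eta_i}{\partial y_j}(y)\Big)\in\mathfrak g\ \text{for all } y \text{ near } 0\Big\},$$ a space of germs of vector fields $\eta=\sum_i\eta_i\,\partial/\partial y_i$ vanishing at $0$. Let $\mathrm{Diff}[G](p)$ be the set of diffeomorphism germs $\psi:(\mathbb R^p,0)\to(\mathbb R^p,0)$ whose Jacobi matrix $J_\psi(y)$ lies in $G$ for all $y$ near $0$, and let $\mathrm{Diff}_0[G](p)$ be the set of those $\psi\in\mathrm{Diff}[G](p)$ for which there is a family $\Psi(y,t)=\psi_t(y)$, $C^\infty$ in $(y,t)$ on a neighbourhood of $\{0\}\times[0,1]$, with $\psi_t\in\mathrm{Diff}[G](p)$ for all $t\in[0,1]$, $\psi_0=\mathrm{id}$ and $\psi_1=\psi$. Suppose that one of the following conditions holds: 1. $\mathfrak g\cong\theta[G]_0(p)$ as $\mathbb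 R$-vector spaces; 2. for every $\eta\in\theta[G]_0(p)$ the components $\eta_1,\dots,\eta_p$ are germs of linear functions; 3. $\mathrm{Diff}_0[G](p)=G$, where $A\in G$ is identified with the germ of $y\mapsto Ay$. For a map germ $f:(\mathbb R^n,0)\to(\mathbb R^p,0)$ let $$R(f)=\{df\circ\zeta\mid \zeta \text{ a vector field germ on } (\mathbb R^n,0),\ \zeta(0)=0\},$$ $$T\mathcal A[G](f)=R(f)+\{\eta\circ f\mid\eta\in\theta[G]_0(p)\},\qquad T(\mathcal R\times G)(f)=R(f)+\{X f\mid X\in\mathfrak g\},$$ where $(Xf)(x)=X\,f(x)$. Then for every $n$ and every map germ $f:(\mathbb R^n,0)\to(\mathbb R^p,0)$ we have $T(\mathcal R\times G)(f)\subset T\mathcal A[G](f)$, and the relative infinitesimal moduli space $T\mathcal A[G](f)/T(\mathcal R\times G)(f)$ is zero. -/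

import Mathlib

open scoped Topology ContDiff Matrix

namespace GeometricEquivalence

/-- `h` represents a `C^∞` map germ `(ℝⁿ, 0) → ℝᵖ`: it is `C^∞` at all points near the origin. -/
def SmoothNearZero {n p : ℕ} (h : (Fin n → ℝ) → (Fin p → ℝ)) : Prop :=
  ∀ᶠ x in 𝓝 (0 : Fin n → ℝ), ContDiffAt ℝ ∞ h x

/-- The real vector space of all germs at the origin of maps `ℝⁿ → ℝᵖ`, in which all the
spaces of smooth germs below live. -/
abbrev Germs (n p : ℕ) : Type := Filter.Germ (𝓝 (0 : Fin n → ℝ)) (Fin p → ℝ)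

/-- A map germ `f : (ℝⁿ, 0) → (ℝᵖ, 0)` of class `C^∞`, given by a representative. Everything
built from it below depends only on its germ at the origin. -/
structure MapGerm (n p : ℕ) where
  toFun : (Fin n → ℝ) → (Fin p → ℝ)
  smooth : SmoothNearZero toFun
  map_zero : toFun 0 = 0

theorem MapGerm.tendsto {n p : ℕ} (f : MapGerm n p) :
    Filter.Tendsto f.toFun (𝓝 0) (𝓝 0) := by
  have h : ContinuousAt f.toFun 0 := (f.smooth.self_of_nhds).continuousAt
  simpa [ContinuousAt, f.map_zero] using h

/-- The Jacobi matrix `(∂hᵢ/∂xⱼ)(x)`. -/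
noncomputable def jacobi {n p : ℕ} (h : (Fin n → ℝ) → (Fin p → ℝ)) (x : Fin n → ℝ) :
    Matrix (Fin p) (Fin n) ℝ :=
  LinearMap.toMatrix' (fderiv ℝ h x : (Fin n → ℝ) →ₗ[ℝ] (Fin p → ℝ))

/-- `𝔐ₙ θ(f)`, identified with the space of germs of `C^∞` maps `(ℝⁿ, 0) → (ℝᵖ, 0)`.
For `p = n` this is `𝔐ₙ θ(n)`, the space of vector field germs on `(ℝⁿ, 0)` vanishing at `0`. -/
def maxTheta (n p : ℕ) : Submodule ℝ (Germs n p) where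
  carrier := {g | ∃ h : (Fin n → ℝ) → (Fin p → ℝ), SmoothNearZero h ∧ h 0 = 0 ∧ g = Filter.Germ.ofFun h}
  zero_mem' := ⟨0, Filter.Eventually.of_forall fun _ => contDiffAt_const, rfl, rfl⟩
  add_mem' := by
    rintro _ _ ⟨h, hs, h0, rfl⟩ ⟨k, ks, k0, rfl⟩
    refine ⟨h + k, ?_, by simp [h0, k0], rfl⟩
    filter_upwards [hs, ks] with x hx kx using hx.add kx
  smul_mem' := by
    rintro c _ ⟨h, hs, h0, rfl⟩
    refine ⟨c • h, ?_, by simp [h0], rfl⟩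
    filter_upwards [hs] with x hx using hx.const_smul c

/-- The Lie algebra `𝔤 = T_I G ⊂ M_p(ℝ)` of a subgroup `G` of `GL(p, ℝ)`: the velocities at `t = 0`
of the curves in `G` through the identity that are `C^∞` near `t = 0`. -/
def lieAlg {p : ℕ} (G : Subgroup (GL (Fin p) ℝ)) : Submodule ℝ (Matrix (Fin p) (Fin p) ℝ) where
  carrier := {X | ∃ γ : ℝ → GL (Fin p) ℝ, (∀ t, γ t ∈ G) ∧ γ 0 = 1 ∧
    (∀ i j, ∀ᶠ t in 𝓝 (0 : ℝ), ContDiffAt ℝ ∞ (fun s => (γ s).val i j) t) ∧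
    ∀ i j, HasDerivAt (fun s => (γ s).val i j) (X i j) 0}
  zero_mem' := ⟨fun _ => 1, fun _ => G.one_mem, rfl,
    fun _ _ => Filter.Eventually.of_forall fun _ => contDiffAt_const,
    fun _ _ => hasDerivAt_const _ _⟩
  add_mem' := by
    rintro X Y ⟨γ, hγ, γ0, γs, γd⟩ ⟨δ, hδ, δ0, δs, δd⟩
    refine ⟨fun t => γ t * δ t, fun t => G.mul_mem (hγ t) (hδ t), by simp [γ0, δ0], ?_, ?_⟩
    · intro i j
      have h1 : ∀ᶠ t in 𝓝 (0 : ℝ), ∀ k, ContDiffAt ℝ ∞ (fun s => (γ s).val i k) t :=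
        Filter.eventually_all.2 fun k => γs i k
      have h2 : ∀ᶠ t in 𝓝 (0 : ℝ), ∀ k, ContDiffAt ℝ ∞ (fun s => (δ s).val k j) t :=
        Filter.eventually_all.2 fun k => δs k j
      filter_upwards [h1, h2] with t a b
      simp only [Units.val_mul, Matrix.mul_apply]
      exact ContDiffAt.sum fun k _ => (a k).mul (b k)
    · intro i j
      have h := HasDerivAt.fun_sum (u := Finset.univ) fun k _ => (γd i k).mul (δd k j)
      simp only [Units.val_mul, Matrix.mul_apply]
      refine h.congr_deriv ?_
      simp [γ0, δ0, Matrix.one_apply, Finset.sum_add_distrib]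
  smul_mem' := by
    rintro c X ⟨γ, hγ, γ0, γs, γd⟩
    have hc : Filter.Tendsto (fun t : ℝ => c * t) (𝓝 0) (𝓝 0) := by
      have : Continuous fun t : ℝ => c * t := by fun_prop
      simpa using this.tendsto 0
    refine ⟨fun t => γ (c * t), fun t => hγ _, by simp [γ0], ?_, ?_⟩
    · intro i j
      filter_upwards [hc.eventually (γs i j)] with t ht
      exact ContDiffAt.comp t (g := fun s => (γ s).val i j) ht (contDiffAt_const.mul contDiffAt_id)
    · intro i j
      have h1 : HasDerivAt (fun t : ℝ => c * t) c 0 := by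
        simpa using (hasDerivAt_id (0 : ℝ)).const_mul c
      have h2 : HasDerivAt (fun s => (γ s).val i j) (X i j) (c * 0) := by simpa using γd i j
      have h := h2.comp (0 : ℝ) h1
      simpa [Function.comp_def, mul_comm] using h

/-- `θ[G]₀(p)`: the germs of vector fields `η` on `(ℝᵖ, 0)` with `η(0) = 0` and
`(∂ηᵢ/∂yⱼ)(y) ∈ 𝔤` for all `y` near the origin. -/
def thetaZero {p : ℕ} (G : Subgroup (GL (Fin p) ℝ)) : Submodule ℝ (Germs p p) where
  carrier := {g | ∃ η : (Fin p → ℝ) → (Fin p → ℝ), SmoothNearZero η ∧ η 0 = 0 ∧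
    (∀ᶠ y in 𝓝 (0 : Fin p → ℝ), jacobi η y ∈ lieAlg G) ∧ g = Filter.Germ.ofFun η}
  zero_mem' := by
    refine ⟨0, Filter.Eventually.of_forall fun _ => contDiffAt_const, rfl,
      Filter.Eventually.of_forall fun y => ?_, rfl⟩
    have : jacobi (0 : (Fin p → ℝ) → (Fin p → ℝ)) y = 0 := by simp [jacobi]
    rw [this]
    exact zero_mem _
  add_mem' := by
    rintro _ _ ⟨h, hs, h0, hJ, rfl⟩ ⟨k, ks, k0, kJ, rfl⟩
    refine ⟨h + k, ?_, by simp [h0, k0], ?_, rfl⟩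
    · filter_upwards [hs, ks] with x hx kx using hx.add kx
    · filter_upwards [hs, ks, hJ, kJ] with x hx kx hJx kJx
      have : jacobi (h + k) x = jacobi h x + jacobi k x := by
        simp [jacobi, fderiv_add (hx.differentiableAt (by simp)) (kx.differentiableAt (by simp))]
      rw [this]
      exact add_mem hJx kJx
  smul_mem' := by
    rintro c _ ⟨h, hs, h0, hJ, rfl⟩
    refine ⟨c • h, ?_, by simp [h0], ?_, rfl⟩
    · filter_upwards [hs] with x hx using hx.const_smul c
    · filter_upwards [hs, hJ] with x hx hJx
      have : jacobi (c • h) x = c • jacobi h x := by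
        simp [jacobi, fderiv_const_smul (hx.differentiableAt (by simp))]
      rw [this]
      exact Submodule.smul_mem _ _ hJx

/-- `tf(ζ) = df ∘ ζ`. -/
noncomputable def tf {n p : ℕ} (f : MapGerm n p) : Germs n n →ₗ[ℝ] Germs n p where
  toFun ζ := Filter.Germ.map₂ (fun (L : (Fin n → ℝ) →L[ℝ] (Fin p → ℝ)) v => L v)
    (Filter.Germ.ofFun (fun x => fderiv ℝ f.toFun x)) ζ
  map_add' ζ ξ := by
    induction ζ using Filter.Germ.inductionOn with | _ ζ
    induction ξ using Filter.Germ.inductionOn with | _ ξ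
    exact congrArg _ (funext fun x => map_add (fderiv ℝ f.toFun x) (ζ x) (ξ x))
  map_smul' c ζ := by
    induction ζ using Filter.Germ.inductionOn with | _ ζ
    exact congrArg _ (funext fun x => map_smul (fderiv ℝ f.toFun x) c (ζ x))

/-- `ωf(ξ) = ξ ∘ f`. -/
def omegaf {n p : ℕ} (f : MapGerm n p) : Germs p p →ₗ[ℝ] Germs n p where
  toFun ξ := ξ.compTendsto f.toFun f.tendsto
  map_add' ζ ξ := by
    induction ζ using Filter.Germ.inductionOn with | _ ζ
    induction ξ using Filter.Germ.inductionOn with | _ ξ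
    rfl
  map_smul' c ζ := by
    induction ζ using Filter.Germ.inductionOn with | _ ζ
    rfl

/-- The linear map `X ↦ X.f`, where `(X.f)(x) = X f(x)`. -/
def matAct {n p : ℕ} (f : MapGerm n p) : Matrix (Fin p) (Fin p) ℝ →ₗ[ℝ] Germs n p where
  toFun X := Filter.Germ.ofFun (fun x => X *ᵥ f.toFun x)
  map_add' X Y := congrArg _ (funext fun x => Matrix.add_mulVec X Y (f.toFun x))
  map_smul' c X := congrArg _ (funext fun x => Matrix.smul_mulVec c X (f.toFun x))

/-- `T𝒜[G](f) = tf(𝔐ₙ θ(n)) + ωf(θ[G]₀(p))`. -/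
noncomputable def tangentAG {n p : ℕ} (G : Subgroup (GL (Fin p) ℝ)) (f : MapGerm n p) :
    Submodule ℝ (Germs n p) :=
  (maxTheta n n).map (tf f) ⊔ (thetaZero G).map (omegaf f)

/-- `T(ℛ × G)(f) = tf(𝔐ₙ θ(n)) + 𝔤(f)`, where `𝔤(f) = {X.f | X ∈ 𝔤}`. -/
noncomputable def tangentRG {n p : ℕ} (G : Subgroup (GL (Fin p) ℝ)) (f : MapGerm n p) :
    Submodule ℝ (Germs n p) :=
  (maxTheta n n).map (tf f) ⊔ (lieAlg G).map (matAct f)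

/-- The relative infinitesimal moduli space `T𝒜[G](f) / T(ℛ × G)(f)`. -/
abbrev RelModuli {n p : ℕ} (G : Subgroup (GL (Fin p) ℝ)) (f : MapGerm n p) : Type :=
  ↥(tangentAG G f) ⧸ (tangentRG G f).submoduleOf (tangentAG G f)

/-- `ψ` represents a `C^∞` diffeomorphism germ `(ℝᵖ, 0) → (ℝᵖ, 0)`. -/
def IsDiffeoGerm {p : ℕ} (ψ : (Fin p → ℝ) → (Fin p → ℝ)) : Prop :=
  SmoothNearZero ψ ∧ ψ 0 = 0 ∧ ∃ χ : (Fin p → ℝ) → (Fin p → ℝ),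
    SmoothNearZero χ ∧ χ 0 = 0 ∧ (∀ᶠ y in 𝓝 0, χ (ψ y) = y) ∧ (∀ᶠ y in 𝓝 0, ψ (χ y) = y)

/-- `Diff[G](p)`: the diffeomorphism germs `ψ` of `(ℝᵖ, 0)` with `J_ψ(y) ∈ G` for all `y` near
the origin. -/
def diffG {p : ℕ} (G : Subgroup (GL (Fin p) ℝ)) : Set (Germs p p) :=
  {g | ∃ ψ : (Fin p → ℝ) → (Fin p → ℝ), IsDiffeoGerm ψ ∧
    (∀ᶠ y in 𝓝 (0 : Fin p → ℝ), ∃ A ∈ G, jacobi ψ y = A.val) ∧ g = Filter.Germ.ofFun ψ}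

/-- `Diff₀[G](p)`: the germs in `Diff[G](p)` isotopic to the identity, through a family
`Ψ(y, t) = ψ_t(y)` of germs in `Diff[G](p)`, `t ∈ [0, 1]`, which is `C^∞` in `(y, t)` near
`{0} × [0, 1]`. -/
def diffZero {p : ℕ} (G : Subgroup (GL (Fin p) ℝ)) : Set (Germs p p) :=
  {g | g ∈ diffG G ∧ ∃ Ψ : (Fin p → ℝ) × ℝ → (Fin p → ℝ),
    (∀ᶠ z in 𝓝ˢ (({0} : Set (Fin p → ℝ)) ×ˢ Set.Icc (0 : ℝ) 1), ContDiffAt ℝ ∞ Ψ z) ∧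
    (∀ t ∈ Set.Icc (0 : ℝ) 1, (Filter.Germ.ofFun (fun y => Ψ (y, t)) : Germs p p)
      ∈ diffG G) ∧
    (Filter.Germ.ofFun (fun y => Ψ (y, 0)) : Germs p p)
      = Filter.Germ.ofFun (fun y => y) ∧
    (Filter.Germ.ofFun (fun y => Ψ (y, 1)) : Germs p p) = g}

/-- `G` regarded as a set of germs, through the linear maps `ψ_A(y) = A y`. -/
def linearGerms {p : ℕ} (G : Subgroup (GL (Fin p) ℝ)) : Set (Germs p p) :=
  {g | ∃ A ∈ G, g = Filter.Germ.ofFun (fun y => A.val *ᵥ y)}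

/-- `𝔤 ≅ θ[G]₀(p)` as real vector spaces. -/
def LieAlgIsoTheta {p : ℕ} (G : Subgroup (GL (Fin p) ℝ)) : Prop :=
  Nonempty (↥(lieAlg G) ≃ₗ[ℝ] ↥(thetaZero G))

/-- Every `η ∈ θ[G]₀(p)` has (germs of) linear functions as its components. -/
def ThetaLinear {p : ℕ} (G : Subgroup (GL (Fin p) ℝ)) : Prop :=
  ∀ η ∈ thetaZero G, ∀ i : Fin p, ∃ l : (Fin p → ℝ) →ₗ[ℝ] ℝ,
    Filter.Germ.map (fun v : Fin p → ℝ => v i) η = Filter.Germ.ofFun (fun y => l y)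

/-- `Diff₀[G](p) = G`. -/
def DiffZeroEq {p : ℕ} (G : Subgroup (GL (Fin p) ℝ)) : Prop :=
  diffZero G = linearGerms G

end GeometricEquivalence

namespace GeometricEquivalence

open scoped unitInterval

/-! ### Linear germs in `θ[G]₀(p)`, and when they exhaust it -/

section

variable {n p : ℕ} {G : Subgroup (GL (Fin p) ℝ)}

/-! Linear fields `y ↦ X y` with `X ∈ 𝔤` always lie in `θ[G]₀(p)`, and composing them with `f` gives
`𝔤(f)`. Everything reduces to showing that each of the three conditions makes every element of
`θ[G]₀(p)` such a field (`tangentAG_eq_tangentRG`). Under the first this is a dimension count; under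
the second, `η` is its own Jacobi matrix at `0`, which lies in `𝔤`.

Under the third, let `B` be the second derivative of `η` at a point near `0`: a symmetric bilinear
map with all `B(v, ·)` in `𝔤`. The quadratic field `B(y, y) / 2` has Jacobi matrix `B(y, ·)`, so the
linearization of its flow solves `M' = A M` with `A` in `𝔤` and stays in the closed group `G`
(`mem_closure_of_linear_ode`, `timeOne_mem_diffG`). The flow therefore lies in `Diff₀[G](p)`, so it
is linear; its derivative at `0` is the identity, so it is the identity germ. Its quadratic term
then forces `B = 0` (`eq_zero_of_timeOne_eq_id`). Hence second derivatives vanish and `η` is linear.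
-/

theorem jacobi_mulVec (h : (Fin n → ℝ) → (Fin p → ℝ)) (x v : Fin n → ℝ) :
    jacobi h x *ᵥ v = fderiv ℝ h x v := by
  rw [jacobi, ← Matrix.toLin'_apply, Matrix.toLin'_toMatrix']
  rfl

theorem fderiv_mulVec (X : Matrix (Fin p) (Fin n) ℝ) (x : Fin n → ℝ) :
    fderiv ℝ (fun y => X *ᵥ y) x = LinearMap.toContinuousLinearMap (Matrix.mulVecLin X) :=
  (LinearMap.toContinuousLinearMap (Matrix.mulVecLin X)).fderiv

theorem jacobi_mulVec_eq (X : Matrix (Fin p) (Fin n) ℝ) (x : Fin n → ℝ) :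
    jacobi (fun y => X *ᵥ y) x = X := by
  rw [jacobi, fderiv_mulVec]
  exact LinearMap.toMatrix'_toLin' X

theorem contDiff_mulVec {k : WithTop ℕ∞} (X : Matrix (Fin p) (Fin n) ℝ) :
    ContDiff ℝ k (fun y : Fin n → ℝ => X *ᵥ y) :=
  (LinearMap.toContinuousLinearMap (Matrix.mulVecLin X)).contDiff

/-- The linear map sending a matrix `X` to the germ of `y ↦ X y`. -/
def linearGerm (p : ℕ) : Matrix (Fin p) (Fin p) ℝ →ₗ[ℝ] Germs p p where
  toFun X := Filter.Germ.ofFun (fun y => X *ᵥ y)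
  map_add' X Y := congrArg _ (funext fun y => Matrix.add_mulVec X Y y)
  map_smul' c X := congrArg _ (funext fun y => Matrix.smul_mulVec c X y)

theorem jacobi_congr {h k : (Fin n → ℝ) → (Fin p → ℝ)} {x : Fin n → ℝ} (e : h =ᶠ[𝓝 x] k) :
    jacobi h x = jacobi k x := by
  rw [jacobi, jacobi, e.fderiv_eq]

theorem linearGerm_injective : Function.Injective (linearGerm p) := by
  intro X Y h
  have e : (fun y : Fin p → ℝ => X *ᵥ y) =ᶠ[𝓝 0] fun y => Y *ᵥ y := Filter.Germ.coe_eq.1 h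
  simpa only [jacobi_mulVec_eq] using jacobi_congr e

theorem map_linearGerm_le : (lieAlg G).map (linearGerm p) ≤ thetaZero G := by
  rintro _ ⟨X, hX, rfl⟩
  refine ⟨fun y => X *ᵥ y, .of_forall fun y => (contDiff_mulVec X).contDiffAt,
    Matrix.mulVec_zero X, .of_forall fun y => ?_, rfl⟩
  rw [jacobi_mulVec_eq]
  exact hX

theorem tangentAG_eq_tangentRG (h : thetaZero G ≤ (lieAlg G).map (linearGerm p))
    (f : MapGerm n p) : tangentAG G f = tangentRG G f := by
  have e : thetaZero G = (lieAlg G).map (linearGerm p) := le_antisymm h map_linearGerm_le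
  rw [tangentAG, tangentRG, e, ← Submodule.map_comp]
  rfl

/-- An abstract isomorphism suffices: `𝔤` is finite-dimensional and embeds in `θ[G]₀(p)` as linear
germs, so equal dimensions force equality. -/
theorem thetaZero_le_of_iso (h : LieAlgIsoTheta G) :
    thetaZero G ≤ (lieAlg G).map (linearGerm p) := by
  obtain ⟨e⟩ := h
  have : FiniteDimensional ℝ (thetaZero G) := e.finiteDimensional
  refine (Submodule.eq_of_le_of_finrank_eq map_linearGerm_le ?_).ge
  rw [← e.finrank_eq]
  exact (Submodule.equivMapOfInjective _ linearGerm_injective _).symm.finrank_eq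

theorem thetaZero_le_of_linear (h : ThetaLinear G) :
    thetaZero G ≤ (lieAlg G).map (linearGerm p) := by
  intro g hg
  have hl := h g hg
  obtain ⟨η, -, -, hJ, rfl⟩ := hg
  choose l hl using hl
  have e : η =ᶠ[𝓝 0] fun y => LinearMap.toMatrix' (LinearMap.pi l) *ᵥ y := by
    have : ∀ᶠ y in 𝓝 (0 : Fin p → ℝ), ∀ i, η y i = l i y :=
      Filter.eventually_all.2 fun i => Filter.Germ.coe_eq.1 (hl i)
    filter_upwards [this] with y hy
    rw [LinearMap.toMatrix'_mulVec]
    exact funext hy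
  refine ⟨LinearMap.toMatrix' (LinearMap.pi l), ?_, (Filter.Germ.coe_eq.2 e).symm⟩
  have := hJ.self_of_nhds
  rwa [jacobi_congr e, jacobi_mulVec_eq] at this

/-- If all second derivatives of vector fields in `θ[G]₀(p)` vanish near the origin, these vector
fields are linear. -/
theorem thetaZero_le_of_fderiv_fderiv
    (h : ∀ η : (Fin p → ℝ) → (Fin p → ℝ), SmoothNearZero η →
      (∀ᶠ y in 𝓝 (0 : Fin p → ℝ), jacobi η y ∈ lieAlg G) →
      ∀ᶠ y in 𝓝 0, fderiv ℝ (fderiv ℝ η) y = 0) :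
    thetaZero G ≤ (lieAlg G).map (linearGerm p) := by
  rintro _ ⟨η, hη, η0, hJ, rfl⟩
  refine ⟨jacobi η 0, hJ.self_of_nhds, Filter.Germ.coe_eq.2 ?_⟩
  obtain ⟨ε, ε0, hε⟩ := Metric.eventually_nhds_iff_ball.1 ((h η hη hJ).and hη)
  -- The mean value theorem on a ball is used twice: for `fderiv ℝ η`, then for `η` minus its linear
  -- part.
  have hsm : ∀ y ∈ Metric.ball (0 : Fin p → ℝ) ε, fderiv ℝ η y = fderiv ℝ η 0 := by
    intro y hy
    refine (convex_ball _ _).is_const_of_fderivWithin_eq_zero (𝕜 := ℝ) (f := fderiv ℝ η)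
      (fun z hz => ?_) (fun z hz => ?_) hy (Metric.mem_ball_self ε0)
    · exact (((hε z hz).2.fderiv_right (m := 1) (by norm_cast)).differentiableAt
        one_ne_zero).differentiableWithinAt
    · rw [fderivWithin_of_isOpen Metric.isOpen_ball hz, (hε z hz).1]
  filter_upwards [Metric.ball_mem_nhds 0 ε0] with y hy
  rw [jacobi_mulVec]
  have hd : ∀ z ∈ Metric.ball (0 : Fin p → ℝ) ε, HasFDerivAt η (fderiv ℝ η 0) z := fun z hz => by
    have := ((hε z hz).2.differentiableAt (by simp)).hasFDerivAt
    rwa [hsm z hz] at this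
  have := (convex_ball (0 : Fin p → ℝ) ε).is_const_of_fderivWithin_eq_zero (𝕜 := ℝ)
    (f := fun z => η z - fderiv ℝ η 0 z)
    (fun z hz => ((hd z hz).sub (fderiv ℝ η 0).hasFDerivAt).differentiableAt.differentiableWithinAt)
    (fun z hz => by
      rw [fderivWithin_of_isOpen Metric.isOpen_ball hz,
        ((hd z hz).fun_sub (fderiv ℝ η 0).hasFDerivAt).fderiv, sub_self]) hy
    (Metric.mem_ball_self ε0)
  simp only [η0, map_zero, sub_zero] at this
  exact (sub_eq_zero.1 this).symm

/-- The second derivative of a vector field with Jacobi matrices in `𝔤` takes values in `𝔤`. -/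
theorem toMatrix'_fderiv_fderiv_mem {η : (Fin p → ℝ) → (Fin p → ℝ)} {y : Fin p → ℝ}
    (hη : ContDiffAt ℝ ∞ η y) (hJ : ∀ᶠ z in 𝓝 y, jacobi η z ∈ lieAlg G) (v : Fin p → ℝ) :
    LinearMap.toMatrix' (fderiv ℝ (fderiv ℝ η) y v : (Fin p → ℝ) →ₗ[ℝ] (Fin p → ℝ)) ∈ lieAlg G := by
  have hd : HasFDerivAt (fderiv ℝ η) (fderiv ℝ (fderiv ℝ η) y) y :=
    ((hη.fderiv_right (m := 1) (by norm_cast)).differentiableAt one_ne_zero).hasFDerivAt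
  let T : ((Fin p → ℝ) →L[ℝ] (Fin p → ℝ)) →ₗ[ℝ] Matrix (Fin p) (Fin p) ℝ :=
    LinearMap.toMatrix'.toLinearMap ∘ₗ ContinuousLinearMap.coeLM ℝ
  let S := (lieAlg G).comap T
  -- A finite-dimensional subspace is closed, so limits of difference quotients of Jacobi matrices
  -- remain in `𝔤`.
  have hS : IsClosed (S : Set ((Fin p → ℝ) →L[ℝ] (Fin p → ℝ))) := S.closed_of_finiteDimensional
  have hl : HasDerivAt (fun t : ℝ => fderiv ℝ η (y + t • v)) (fderiv ℝ (fderiv ℝ η) y v) 0 := by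
    have h1 : HasDerivAt (fun t : ℝ => y + t • v) v 0 := by
      simpa using ((hasDerivAt_id (0 : ℝ)).smul_const v).const_add y
    have h2 : HasFDerivAt (fderiv ℝ η) (fderiv ℝ (fderiv ℝ η) y) (y + (0 : ℝ) • v) := by simpa
    exact h2.comp_hasDerivAt 0 h1
  have hc : Filter.Tendsto (fun t : ℝ => y + t • v) (𝓝[≠] 0) (𝓝 y) := by
    have : Continuous fun t : ℝ => y + t • v := by fun_prop
    simpa using (this.tendsto 0).mono_left nhdsWithin_le_nhds
  refine hS.mem_of_tendsto (hasDerivAt_iff_tendsto_slope.1 hl) ?_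
  filter_upwards [hc.eventually hJ] with t ht
  rw [slope_def_module]
  refine S.smul_mem _ (S.sub_mem ht ?_)
  have := hJ.self_of_nhds
  simpa [S, T, jacobi] using this

end

/-! ### Linear differential equations and closed groups -/

section

/-- A solution of `M' = A M` that starts in `S` stays in the closure of `S`, if each `A t` is the
velocity at `0` of a curve through `1` whose left translations preserve `S`. -/
theorem mem_closure_of_linear_ode {𝔸 : Type*} [NormedRing 𝔸] [NormedAlgebra ℝ 𝔸]
    {S : Set 𝔸} {M A : ℝ → 𝔸} {C : ℝ} (hM : ContinuousOn M (Set.Icc 0 1))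
    (hM' : ∀ t ∈ Set.Ico (0 : ℝ) 1, HasDerivWithinAt M (A t * M t) (Set.Ici t) t)
    (hC : ∀ t ∈ Set.Ico (0 : ℝ) 1, ‖A t‖ ≤ C)
    (hA : ∀ t ∈ Set.Ico (0 : ℝ) 1, ∃ γ : ℝ → 𝔸, γ 0 = 1 ∧ HasDerivAt γ (A t) 0 ∧
      ∀ s, ∀ g ∈ S, γ s * g ∈ S)
    (h0 : M 0 ∈ S) : M 1 ∈ closure S := by
  have hne : S.Nonempty := ⟨_, h0⟩
  -- Grönwall for the distance from `M t` to `S`: it starts at `0` and its right derivative is at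
  -- most `C` times itself.
  have key := le_gronwallBound_of_liminf_deriv_right_le (f := fun t => Metric.infDist (M t) S)
    (f' := fun t => C * Metric.infDist (M t) S) (δ := 0) (K := C) (ε := 0) (a := 0) (b := 1)
    ((Metric.continuous_infDist_pt S).comp_continuousOn hM) ?_
    (by rw [Metric.infDist_zero_of_mem h0]) (fun t _ => by simp) 1 (by simp)
  · rw [gronwallBound_ε0_δ0] at key
    rw [Metric.mem_closure_iff_infDist_zero hne]
    exact le_antisymm key Metric.infDist_nonneg
  intro t ht r hr
  obtain ⟨γ, γ0, γd, γS⟩ := hA t ht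
  set d := Metric.infDist (M t) S with hd
  have d0 : 0 ≤ d := Metric.infDist_nonneg
  have h1 : HasDerivWithinAt (fun z => γ (z - t)) (A t) (Set.Ici t) t := by
    have : HasDerivAt (fun z => z - t) 1 t := (hasDerivAt_id t).sub_const t
    have h' : HasDerivAt γ (A t) (t - t) := by simpa using γd
    simpa [Function.comp_def] using (HasDerivAt.scomp (h := fun z => z - t) t h' this).hasDerivWithinAt
  -- To first order, `M` moves by left translation along `γ`, which preserves `S` and expands norms
  -- by at most `1 + (C + ε)(z - t)`.
  have h2 : HasDerivWithinAt (fun z => M z - γ (z - t) * M t) 0 (Set.Ici t) t := by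
    simpa using (hM' t ht).fun_sub (h1.mul_const (M t))
  obtain ⟨ε, ε0, hε⟩ : ∃ ε > 0, ε + (C + ε) * d < r := by
    have hc : Filter.Tendsto (fun ε : ℝ => ε + (C + ε) * d) (𝓝[>] 0) (𝓝 (C * d)) := by
      have : Continuous fun ε : ℝ => ε + (C + ε) * d := by fun_prop
      simpa using (this.tendsto 0).mono_left nhdsWithin_le_nhds
    obtain ⟨ε, h, h'⟩ := ((hc.eventually (gt_mem_nhds hr)).and self_mem_nhdsWithin).exists
    exact ⟨ε, h', h⟩
  refine Filter.Eventually.frequently ?_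
  have e1 := (hasDerivWithinAt_iff_isLittleO.1 h1).def ε0
  have e2 := (hasDerivWithinAt_iff_isLittleO.1 h2).def ε0
  have hle : 𝓝[>] t ≤ 𝓝[Set.Ici t] t := nhdsWithin_mono _ Set.Ioi_subset_Ici_self
  filter_upwards [hle e1, hle e2, self_mem_nhdsWithin] with z hz1 hz2 hz
  have hz' : 0 < z - t := sub_pos.2 hz
  simp only [sub_self, γ0, one_mul, smul_zero, sub_zero, Real.norm_eq_abs, abs_of_pos hz']
    at hz1 hz2
  have n1 : ‖γ (z - t) - 1‖ ≤ (C + ε) * (z - t) := by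
    calc ‖γ (z - t) - 1‖ = ‖(γ (z - t) - 1 - (z - t) • A t) + (z - t) • A t‖ := by
          rw [sub_add_cancel]
      _ ≤ ‖γ (z - t) - 1 - (z - t) • A t‖ + ‖(z - t) • A t‖ := norm_add_le _ _
      _ ≤ ε * (z - t) + (z - t) * C := by
          rw [norm_smul, Real.norm_eq_abs, abs_of_pos hz']
          gcongr
          exact hC t ht
      _ = _ := by ring
  have n3 : ∀ x, ‖γ (z - t) * x‖ ≤ (1 + (C + ε) * (z - t)) * ‖x‖ := fun x => by
    calc ‖γ (z - t) * x‖ = ‖x + (γ (z - t) - 1) * x‖ := by rw [sub_mul, one_mul, add_sub_cancel]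
      _ ≤ ‖x‖ + (C + ε) * (z - t) * ‖x‖ := (norm_add_le _ _).trans
          (add_le_add_right ((norm_mul_le _ _).trans
            (mul_le_mul_of_nonneg_right n1 (norm_nonneg _))) _)
      _ = _ := by ring
  have n2 : Metric.infDist (M z) S ≤ ε * (z - t) + (1 + (C + ε) * (z - t)) * d := by
    -- The distance need not be attained: take `g ∈ S` almost nearest to `M t` and compare `M z`
    -- with `γ (z - t) * g ∈ S`.
    refine le_of_forall_pos_le_add fun e he => ?_
    have hpos : 0 < 1 + (C + ε) * (z - t) + 1 := by
      have := norm_nonneg (γ (z - t) - 1); linarith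
    obtain ⟨g, gS, hg⟩ := (Metric.infDist_lt_iff (x := M t) hne).1
      (lt_add_of_pos_right d (div_pos he hpos))
    calc Metric.infDist (M z) S ≤ dist (M z) (γ (z - t) * g) :=
          Metric.infDist_le_dist_of_mem (γS _ g gS)
      _ = ‖(M z - γ (z - t) * M t) + γ (z - t) * (M t - g)‖ := by
          rw [dist_eq_norm, mul_sub]; congr 1; abel
      _ ≤ ε * (z - t) + (1 + (C + ε) * (z - t)) * (d + e / (1 + (C + ε) * (z - t) + 1)) := by
          refine (norm_add_le _ _).trans (add_le_add hz2 ((n3 _).trans ?_))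
          rw [dist_eq_norm] at hg
          have := (norm_nonneg _).trans n1
          gcongr
      _ ≤ _ := by
          rw [mul_add, ← add_assoc]
          gcongr
          rw [← mul_div_assoc, div_le_iff₀ hpos]
          nlinarith
  calc (z - t)⁻¹ * (Metric.infDist (M z) S - d)
      ≤ (z - t)⁻¹ * (ε * (z - t) + (1 + (C + ε) * (z - t)) * d - d) := by gcongr
    _ = ε + (C + ε) * d := by field_simp; ring
    _ < r := hε

/-- `G` is closed only in `GL(p, ℝ)`; its closure among all matrices may contain singular ones, and
invertibility excludes these. -/
theorem mem_of_isUnit_of_mem_closure {p : ℕ} {G : Subgroup (GL (Fin p) ℝ)}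
    (hG : IsClosed (G : Set (GL (Fin p) ℝ))) {X : Matrix (Fin p) (Fin p) ℝ} (hX : IsUnit X)
    (h : X ∈ closure (Units.val '' (G : Set (GL (Fin p) ℝ)))) : ∃ A ∈ G, X = A.val := by
  obtain ⟨u, rfl⟩ := hX
  refine ⟨u, ?_, rfl⟩
  -- This norm serves only to make the units of a complete normed ring openly embedded.
  let _ : NormedRing (Matrix (Fin p) (Fin p) ℝ) := Matrix.linftyOpNormedRing
  let _ : NormedAlgebra ℝ (Matrix (Fin p) (Fin p) ℝ) := Matrix.linftyOpNormedAlgebra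
  have : CompleteSpace (Matrix (Fin p) (Fin p) ℝ) := FiniteDimensional.complete ℝ _
  have e := (Units.isOpenEmbedding_val (R := Matrix (Fin p) (Fin p) ℝ)).isInducing
  have : u ∈ closure (G : Set (GL (Fin p) ℝ)) :=
    (e.closure_eq_preimage_closure_image (G : Set (GL (Fin p) ℝ))).ge h
  rwa [hG.closure_eq] at this

end

/-! ### Integral curves of a quadratic field, by the implicit function theorem in `C(I, E)` -/

section

variable {E : Type*} [NormedAddCommGroup E] [NormedSpace ℝ E]

theorem continuous_integrand (B : E →L[ℝ] E →L[ℝ] E) (u v : C(I, E)) :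
    Continuous fun r : ℝ => B (u (Set.projIcc 0 1 zero_le_one r))
      (v (Set.projIcc 0 1 zero_le_one r)) := by fun_prop

/-- The curve `s ↦ ∫₀ˢ B(u, v)` for curves `u`, `v : [0, 1] → E`. -/
noncomputable def curveIntegral (B : E →L[ℝ] E →L[ℝ] E) (u v : C(I, E)) : C(I, E) where
  toFun s := ∫ r in (0 : ℝ)..s, B (u (Set.projIcc 0 1 zero_le_one r))
    (v (Set.projIcc 0 1 zero_le_one r))
  continuous_toFun :=
    (intervalIntegral.continuous_primitive
      (fun a b => (continuous_integrand B u v).intervalIntegrable a b) 0).comp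
      continuous_subtype_val

/-- `curveIntegral` as a bounded bilinear map. -/
noncomputable def curveIntegralL (B : E →L[ℝ] E →L[ℝ] E) : C(I, E) →L[ℝ] C(I, E) →L[ℝ] C(I, E) :=
  LinearMap.mkContinuous₂ (LinearMap.mk₂ ℝ (curveIntegral B)
    (fun u u' v => by
      ext s
      simp only [curveIntegral, ContinuousMap.coe_mk, ContinuousMap.add_apply, map_add,
        _root_.add_apply]
      exact intervalIntegral.integral_add ((continuous_integrand B u v).intervalIntegrable _ _)
        ((continuous_integrand B u' v).intervalIntegrable _ _))
    (fun c u v => by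
      ext s
      simp only [curveIntegral, ContinuousMap.coe_mk, ContinuousMap.smul_apply, map_smul,
        _root_.smul_apply]
      exact intervalIntegral.integral_smul _ _)
    (fun u v v' => by
      ext s
      simp only [curveIntegral, ContinuousMap.coe_mk, ContinuousMap.add_apply, map_add]
      exact intervalIntegral.integral_add ((continuous_integrand B u v).intervalIntegrable _ _)
        ((continuous_integrand B u v').intervalIntegrable _ _))
    (fun c u v => by
      ext s
      simp only [curveIntegral, ContinuousMap.coe_mk, ContinuousMap.smul_apply, map_smul]
      exact intervalIntegral.integral_smul _ _)) ‖B‖ (fun u v => by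
    refine (ContinuousMap.norm_le _ (by positivity)).2 fun s => ?_
    refine (intervalIntegral.norm_integral_le_of_norm_le_const (C := ‖B‖ * ‖u‖ * ‖v‖)
      fun r _ => ?_).trans ?_
    · refine (B.le_opNorm₂ _ _).trans ?_
      gcongr
      · exact u.norm_coe_le_norm _
      · exact v.norm_coe_le_norm _
    · rw [sub_zero, abs_of_nonneg s.2.1]
      exact mul_le_of_le_one_right (by positivity) s.2.2)

theorem curveIntegralL_apply (B : E →L[ℝ] E →L[ℝ] E) (u v : C(I, E)) (s : I) :
    curveIntegralL B u v s = ∫ r in (0 : ℝ)..s, B (u (Set.projIcc 0 1 zero_le_one r))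
      (v (Set.projIcc 0 1 zero_le_one r)) := rfl

/-- Constant curves, as a bounded linear map. -/
noncomputable def constCurve (E : Type*) [NormedAddCommGroup E] [NormedSpace ℝ E] :
    E →L[ℝ] C(I, E) :=
  LinearMap.mkContinuous
    { toFun := fun y => ContinuousMap.const I y
      map_add' := fun _ _ => rfl
      map_smul' := fun _ _ => rfl } 1 fun y => by
    rw [one_mul]
    exact (ContinuousMap.norm_le _ (norm_nonneg y)).2 fun _ => le_rfl

@[simp]
theorem constCurve_apply (y : E) (s : I) : constCurve E y s = y := rfl

/-- Near the origin, the integral equation `u = y + (τ / 2) ∫ B(u, u)` has a solution `u` depending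
analytically on `(y, τ)`. -/
theorem exists_integral_curves [CompleteSpace E] (B : E →L[ℝ] E →L[ℝ] E) :
    ∃ u : E × ℝ → C(I, E), ContDiffAt ℝ ω u 0 ∧
      (∀ᶠ z in 𝓝 (0 : E × ℝ), u z = constCurve E z.1 + (z.2 / 2) • curveIntegralL B (u z) (u z)) ∧
      (∀ᶠ τ in 𝓝 (0 : ℝ), u (0, τ) = 0) ∧ ∀ᶠ y in 𝓝 (0 : E), u (y, 0) = constCurve E y := by
  let F : (E × ℝ) × C(I, E) → C(I, E) := fun w =>
    w.2 - (w.1.2 / 2) • curveIntegralL B w.2 w.2 - constCurve E w.1.1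
  have hF : ContDiff ℝ ω F := by
    have h : ContDiff ℝ ω fun w : (E × ℝ) × C(I, E) => curveIntegralL B w.2 w.2 :=
      ((curveIntegralL B).contDiff.comp contDiff_snd).clm_apply contDiff_snd
    have h' : ContDiff ℝ ω fun w : (E × ℝ) × C(I, E) => w.1.2 / 2 := by fun_prop
    have h'' : ContDiff ℝ ω fun w : (E × ℝ) × C(I, E) => constCurve E w.1.1 :=
      (constCurve E).contDiff.comp (by fun_prop)
    exact (contDiff_snd.sub (h'.smul h)).sub h''
  have F0 : F 0 = 0 := by simp [F]
  -- At `y = 0`, `τ = 0` the map `F` is the identity in the curve variable.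
  have hi : fderiv ℝ F 0 ∘L .inr ℝ (E × ℝ) C(I, E) = ContinuousLinearMap.id ℝ _ := by
    have h1 : HasFDerivAt F (fderiv ℝ F 0) ((0 : E × ℝ), (0 : C(I, E))) :=
      (hF.contDiffAt.differentiableAt (by simp)).hasFDerivAt
    have h2 := h1.comp (0 : C(I, E)) (hasFDerivAt_prodMk_right (0 : E × ℝ) (0 : C(I, E)))
    refine h2.unique ?_
    have : F ∘ (fun v => ((0 : E × ℝ), v)) = id := by
      funext v
      simp [F]
    rw [this]
    exact hasFDerivAt_id _
  have hinv : (fderiv ℝ F 0 ∘L .inr ℝ (E × ℝ) C(I, E)).IsInvertible := by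
    rw [hi]
    exact ⟨ContinuousLinearEquiv.refl ℝ _, rfl⟩
  have ne : (ω : WithTop ℕ∞) ≠ 0 := by simp
  have c := hF.contDiffAt (x := 0)
  have hiff := c.eventually_apply_eq_iff_implicitFunction ne hinv
  refine ⟨c.implicitFunction ne hinv, c.contDiffAt_implicitFunction ne hinv,
    ?_, ?_, ?_⟩
  · filter_upwards [c.eventually_apply_implicitFunction ne hinv] with z hz
    rw [F0] at hz
    simp only [F, sub_eq_zero] at hz
    rw [← hz, sub_add_cancel]
  -- Local uniqueness identifies `u` with the evident solutions: the zero curve for `y = 0`, and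
  -- below, constant curves for `τ = 0`.
  · have hc : Filter.Tendsto (fun τ : ℝ => (((0 : E), τ), (0 : C(I, E)))) (𝓝 0) (𝓝 0) :=
      Continuous.tendsto (by fun_prop) 0
    filter_upwards [hc.eventually hiff] with τ hτ
    exact hτ.1 (by simp [F])
  · have hc : Filter.Tendsto (fun y : E => ((y, (0 : ℝ)), constCurve E y)) (𝓝 0) (𝓝 0) := by
      have := (Continuous.tendsto (f := fun y : E => ((y, (0 : ℝ)), constCurve E y))
        (by fun_prop) 0)
      simpa only [map_zero] using! this
    filter_upwards [hc.eventually hiff] with y hy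
    exact hy.1 (by simp [F])

end

/-! ### The linearized flow and the group `G` -/

section

section Curves

variable {E : Type*} [NormedAddCommGroup E] [NormedSpace ℝ E]

theorem curveIntegralL_comm {B : E →L[ℝ] E →L[ℝ] E} (hB : ∀ v w, B v w = B w v) (u v : C(I, E)) :
    curveIntegralL B u v = curveIntegralL B v u := by
  ext s
  simp only [curveIntegralL_apply, hB (u _)]

theorem hasFDerivAt_slice {u : E × ℝ → C(I, E)} {y : E} {τ : ℝ} (hu : ContDiffAt ℝ ω u (y, τ)) :
    HasFDerivAt (fun x => u (x, τ)) (fderiv ℝ u (y, τ) ∘L .inl ℝ E ℝ) y :=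
  ((hu.differentiableAt (by simp)).hasFDerivAt).comp y (hasFDerivAt_prodMk_left y τ)

/-- The derivative in `y` of the solutions of the integral equation satisfies the linearized
integral equation. -/
theorem fderiv_slice_eq {B : E →L[ℝ] E →L[ℝ] E} (hB : ∀ v w, B v w = B w v)
    {u : E × ℝ → C(I, E)} {y : E} {τ : ℝ} (hu : ContDiffAt ℝ ω u (y, τ))
    (he : ∀ᶠ z in 𝓝 (y, τ),
      u z = constCurve E z.1 + (z.2 / 2) • curveIntegralL B (u z) (u z)) (w : E) :
    fderiv ℝ u (y, τ) (w, 0) =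
      constCurve E w + τ • curveIntegralL B (u (y, τ)) (fderiv ℝ u (y, τ) (w, 0)) := by
  have h1 := hasFDerivAt_slice hu
  have h2 : HasFDerivAt (fun x => constCurve E x + (τ / 2) • curveIntegralL B (u (x, τ)) (u (x, τ)))
      _ y := (constCurve E).hasFDerivAt.fun_add
        ((((curveIntegralL B).hasFDerivAt.comp y h1).clm_apply h1).fun_const_smul (τ / 2))
  have hc : Filter.Tendsto (fun x : E => (x, τ)) (𝓝 y) (𝓝 (y, τ)) :=
    Continuous.tendsto (by fun_prop) y
  have h3 := h1.unique (h2.congr_of_eventuallyEq (hc.eventually he))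
  have h4 := DFunLike.congr_fun h3 w
  simp only [ContinuousLinearMap.comp_apply, ContinuousLinearMap.inl_apply,
    _root_.add_apply, _root_.smul_apply, ContinuousLinearMap.flip_apply] at h4
  refine h4.trans ?_
  -- By symmetry of `B` the two product rule terms agree, which cancels the `1 / 2`.
  rw [curveIntegralL_comm hB (fderiv ℝ u (y, τ) (w, 0)), ← two_smul ℝ, smul_smul,
    div_mul_cancel₀ _ two_ne_zero]

end Curves

variable {p : ℕ} {G : Subgroup (GL (Fin p) ℝ)}

/-- Matrices as continuous linear maps. -/
noncomputable def mulVecL (p : ℕ) :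
    Matrix (Fin p) (Fin p) ℝ →ₗ[ℝ] ((Fin p → ℝ) →L[ℝ] (Fin p → ℝ)) :=
  LinearMap.toContinuousLinearMap.toLinearMap ∘ₗ Matrix.toLin'.toLinearMap

theorem mulVecL_apply (X : Matrix (Fin p) (Fin p) ℝ) (v : Fin p → ℝ) :
    mulVecL p X v = X *ᵥ v := rfl

theorem mulVecL_toMatrix' (T : (Fin p → ℝ) →L[ℝ] (Fin p → ℝ)) :
    mulVecL p (LinearMap.toMatrix' (T : (Fin p → ℝ) →ₗ[ℝ] (Fin p → ℝ))) = T := by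
  ext1 v
  rw [mulVecL_apply, LinearMap.toMatrix'_mulVec]
  rfl

theorem toMatrix'_mulVecL (X : Matrix (Fin p) (Fin p) ℝ) :
    LinearMap.toMatrix' (mulVecL p X : (Fin p → ℝ) →ₗ[ℝ] (Fin p → ℝ)) = X :=
  LinearMap.toMatrix'_toLin' X

theorem mulVecL_mul (X Y : Matrix (Fin p) (Fin p) ℝ) :
    mulVecL p (X * Y) = mulVecL p X * mulVecL p Y := by
  ext1 v
  exact (Matrix.mulVec_mulVec v X Y).symm

theorem mulVecL_one : mulVecL p 1 = 1 := by
  ext1 v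
  exact Matrix.one_mulVec v

/-- The linearization at an integral curve of a quadratic vector field with Jacobi matrices in `𝔤`
ends in the closure of `G`. -/
theorem toMatrix'_mem_closure {T : (Fin p → ℝ) →L[ℝ] (Fin p → ℝ) →L[ℝ] (Fin p → ℝ)}
    (hT : ∀ v, LinearMap.toMatrix' (T v : (Fin p → ℝ) →ₗ[ℝ] (Fin p → ℝ)) ∈ lieAlg G)
    (u : C(I, Fin p → ℝ)) (L : (Fin p → ℝ) →L[ℝ] C(I, Fin p → ℝ))
    (hL : ∀ w, L w = constCurve _ w + curveIntegralL T u (L w)) :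
    LinearMap.toMatrix' (ContinuousMap.evalCLM ℝ (1 : I) ∘L L : (Fin p → ℝ) →ₗ[ℝ] (Fin p → ℝ)) ∈
      closure (Units.val '' (G : Set (GL (Fin p) ℝ))) := by
  -- Clamping the parameter extends the curves continuously to all of `ℝ`.
  let π : ℝ → I := Set.projIcc 0 1 zero_le_one
  have hπ : Continuous π := continuous_projIcc
  let M : ℝ → ((Fin p → ℝ) →L[ℝ] (Fin p → ℝ)) := fun r => ContinuousMap.evalCLM ℝ (π r) ∘L L
  let A : ℝ → ((Fin p → ℝ) →L[ℝ] (Fin p → ℝ)) := fun r => T (u (π r))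
  have hM : Continuous M := continuous_clm_apply.2 fun w => (L w).continuous.comp hπ
  have hA : Continuous A := T.continuous.comp (u.continuous.comp hπ)
  have hAM : Continuous fun r => A r * M r := hA.mul hM
  have hMeq : ∀ t ∈ Set.Icc (0 : ℝ) 1, M t = 1 + ∫ r in (0 : ℝ)..t, A r * M r := by
    intro t ht
    ext1 w
    rw [_root_.add_apply, ContinuousLinearMap.intervalIntegral_apply
      (hAM.intervalIntegrable _ _)]
    have := congrArg (fun c : C(I, Fin p → ℝ) => c (π t)) (hL w)
    simp only [ContinuousMap.add_apply, constCurve_apply, curveIntegralL_apply] at this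
    rw [show ((π t : I) : ℝ) = t from congrArg Subtype.val (Set.projIcc_of_mem zero_le_one ht)]
      at this
    exact this
  have hder : ∀ t ∈ Set.Ico (0 : ℝ) 1, HasDerivWithinAt M (A t * M t) (Set.Ici t) t := by
    intro t ht
    have h1 : HasDerivAt (fun t => 1 + ∫ r in (0 : ℝ)..t, A r * M r) (A t * M t) t :=
      (intervalIntegral.integral_hasDerivAt_right (hAM.intervalIntegrable _ _)
        (hAM.stronglyMeasurableAtFilter _ _) hAM.continuousAt).const_add _
    refine h1.hasDerivWithinAt.congr_of_eventuallyEq ?_ (hMeq t ⟨ht.1, ht.2.le⟩)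
    filter_upwards [Icc_mem_nhdsGE ht.2] with s hs using hMeq s ⟨ht.1.trans hs.1, hs.2⟩
  obtain ⟨C, hC⟩ := isCompact_Icc.exists_bound_of_continuousOn (hA.continuousOn (s := Set.Icc 0 1))
  have key := mem_closure_of_linear_ode (S := mulVecL p '' (Units.val '' (G : Set (GL (Fin p) ℝ))))
    hM.continuousOn hder (fun t ht => hC t ⟨ht.1, ht.2.le⟩) ?_ ?_
  · have h1 : M 1 = ContinuousMap.evalCLM ℝ (1 : I) ∘L L := by
      simp only [M, π, Set.projIcc_right]
      rfl
    rw [h1] at key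
    let R : ((Fin p → ℝ) →L[ℝ] (Fin p → ℝ)) →ₗ[ℝ] Matrix (Fin p) (Fin p) ℝ :=
      LinearMap.toMatrix'.toLinearMap ∘ₗ ContinuousLinearMap.coeLM ℝ
    have hR : Continuous R := R.continuous_of_finiteDimensional
    have := image_closure_subset_closure_image hR ⟨_, key, rfl⟩
    rw [Set.image_image] at this
    have h2 : (fun X => R (mulVecL p X)) = id := funext toMatrix'_mulVecL
    rwa [h2, Set.image_id] at this
  -- The required curve is the one in `G` that witnesses `A t ∈ 𝔤`; left translation by it preserves
  -- `G`.
  · intro t _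
    obtain ⟨γ, hγ, γ0, -, γd⟩ := hT (u (π t))
    refine ⟨fun s => mulVecL p (γ s).val, ?_, ?_, ?_⟩
    · simp only [γ0]
      exact mulVecL_one
    · let Φ : (Fin p → Fin p → ℝ) →L[ℝ] ((Fin p → ℝ) →L[ℝ] (Fin p → ℝ)) :=
        LinearMap.toContinuousLinearMap (mulVecL p)
      have h1 : HasDerivAt (fun s => (fun i j => (γ s).val i j : Fin p → Fin p → ℝ))
          (LinearMap.toMatrix' (A t : (Fin p → ℝ) →ₗ[ℝ] (Fin p → ℝ))) 0 :=
        hasDerivAt_pi.2 fun i => hasDerivAt_pi.2 fun j => γd i j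
      have h2 := Φ.hasFDerivAt.comp_hasDerivAt 0 h1
      have h3 : Φ (LinearMap.toMatrix' (A t : (Fin p → ℝ) →ₗ[ℝ] (Fin p → ℝ))) = A t :=
        mulVecL_toMatrix' (A t)
      rw [h3] at h2
      exact h2
    · rintro s _ ⟨_, ⟨g, hg, rfl⟩, rfl⟩
      exact ⟨_, ⟨γ s * g, G.mul_mem (hγ s) hg, rfl⟩, mulVecL_mul _ _⟩
  · refine ⟨_, ⟨1, G.one_mem, rfl⟩, ?_⟩
    rw [hMeq 0 (by simp), intervalIntegral.integral_same, add_zero]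
    exact mulVecL_one

/-- Inverse function theorem. Regularity `ω` at one point propagates to a neighbourhood, whereas
`ContDiffAt ℝ ∞` at a point does not. -/
theorem isDiffeoGerm_of_fderiv_eq_id {ψ : (Fin p → ℝ) → (Fin p → ℝ)} (hψ : ContDiffAt ℝ ω ψ 0)
    (h0 : ψ 0 = 0) (hd : fderiv ℝ ψ 0 = ContinuousLinearMap.id ℝ _) : IsDiffeoGerm ψ := by
  have smooth : ∀ {φ : (Fin p → ℝ) → (Fin p → ℝ)}, ContDiffAt ℝ ω φ 0 → SmoothNearZero φ :=
    fun h => (h.eventually (by simp)).mono fun _ hx => hx.of_le le_top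
  have hf : HasFDerivAt ψ
      ((ContinuousLinearEquiv.refl ℝ (Fin p → ℝ) : _ ≃L[ℝ] _) : (Fin p → ℝ) →L[ℝ] (Fin p → ℝ)) 0 := by
    have := (hψ.differentiableAt (by simp)).hasFDerivAt
    rwa [hd] at this
  have ne : (ω : WithTop ℕ∞) ≠ 0 := by simp
  have hs := hψ.hasStrictFDerivAt' hf ne
  have hl := hψ.to_localInverse hf ne
  have hr := hs.eventually_right_inverse
  have hl0 := hs.localInverse_apply_image
  rw [h0] at hl hr hl0
  exact ⟨smooth hψ, h0, hs.localInverse ψ _ 0, smooth hl, hl0, hs.eventually_left_inverse, hr⟩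

end

/-! ### Time one maps and the first prolongation of `𝔤` -/

section

variable {n p : ℕ} {G : Subgroup (GL (Fin p) ℝ)}

theorem jacobi_eq_one_of_fderiv_eq_id {ψ : (Fin p → ℝ) → (Fin p → ℝ)} {y : Fin p → ℝ}
    (h : fderiv ℝ ψ y = ContinuousLinearMap.id ℝ _) : jacobi ψ y = 1 := by
  rw [jacobi, h]
  exact LinearMap.toMatrix'_id

theorem continuousAt_jacobi {ψ : (Fin p → ℝ) → (Fin p → ℝ)} {y : Fin p → ℝ}
    (h : ContDiffAt ℝ ω ψ y) : ContinuousAt (jacobi ψ) y := by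
  let R : ((Fin p → ℝ) →L[ℝ] (Fin p → ℝ)) →ₗ[ℝ] Matrix (Fin p) (Fin p) ℝ :=
    LinearMap.toMatrix'.toLinearMap ∘ₗ ContinuousLinearMap.coeLM ℝ
  have hR : Continuous R := R.continuous_of_finiteDimensional
  exact hR.continuousAt.comp (h.fderiv_right (m := 0) le_top).continuousAt

/-- The time one map of the flow of `τ • (y ↦ B(y, y) / 2)` lies in `Diff[G](p)` if `B` takes values
in `𝔤`. -/
theorem timeOne_mem_diffG (hG : IsClosed (G : Set (GL (Fin p) ℝ)))
    {B : (Fin p → ℝ) →L[ℝ] (Fin p → ℝ) →L[ℝ] (Fin p → ℝ)} (hB : ∀ v w, B v w = B w v)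
    (hBG : ∀ v, LinearMap.toMatrix' (B v : (Fin p → ℝ) →ₗ[ℝ] (Fin p → ℝ)) ∈ lieAlg G)
    {u : (Fin p → ℝ) × ℝ → C(I, Fin p → ℝ)} {τ : ℝ} (hu : ContDiffAt ℝ ω u (0, τ))
    (he : ∀ᶠ z in 𝓝 ((0 : Fin p → ℝ), τ),
      u z = constCurve _ z.1 + (z.2 / 2) • curveIntegralL B (u z) (u z))
    (h0 : u (0, τ) = 0) :
    jacobi (fun y => u (y, τ) 1) 0 = 1 ∧
      (Filter.Germ.ofFun (fun y => u (y, τ) 1) : Germs p p) ∈ diffG G := by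
  have hc : Filter.Tendsto (fun y : Fin p → ℝ => (y, τ)) (𝓝 0) (𝓝 (0, τ)) :=
    Continuous.tendsto (by fun_prop) 0
  have hd : ∀ y, ContDiffAt ℝ ω u (y, τ) → fderiv ℝ (fun y => u (y, τ) 1) y =
      ContinuousMap.evalCLM ℝ (1 : I) ∘L (fderiv ℝ u (y, τ) ∘L .inl ℝ _ ℝ) := fun y hy =>
    ((ContinuousMap.evalCLM ℝ (1 : I) : C(I, Fin p → ℝ) →L[ℝ] (Fin p → ℝ)).hasFDerivAt.comp y (hasFDerivAt_slice hy)).fderiv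
  have hψ : ContDiffAt ℝ ω (fun y => u (y, τ) 1) 0 :=
    (ContinuousMap.evalCLM ℝ (1 : I) : C(I, Fin p → ℝ) →L[ℝ] (Fin p → ℝ)).contDiff.contDiffAt.comp 0
      (hu.comp (0 : Fin p → ℝ) (contDiffAt_id.prodMk contDiffAt_const))
  have hid : fderiv ℝ (fun y => u (y, τ) 1) 0 = ContinuousLinearMap.id ℝ _ := by
    rw [hd 0 hu]
    ext1 w
    have := fderiv_slice_eq hB hu he w
    rw [h0, map_zero, _root_.zero_apply, smul_zero, add_zero] at this
    exact congrArg (fun c : C(I, Fin p → ℝ) => c 1) this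
  have hJ := jacobi_eq_one_of_fderiv_eq_id hid
  refine ⟨hJ, _, isDiffeoGerm_of_fderiv_eq_id hψ (by rw [h0]; rfl) hid, ?_, rfl⟩
  -- The Jacobi matrix is `1` at `0`, hence invertible nearby; membership in the closure of `G` then
  -- gives membership in `G`.
  have hdet : ∀ᶠ y in 𝓝 (0 : Fin p → ℝ), (jacobi (fun y => u (y, τ) 1) y).det ≠ 0 := by
    refine ContinuousAt.eventually_ne
      ((continuous_id.matrix_det.continuousAt).comp (continuousAt_jacobi hψ)) ?_
    simp [hJ]
  filter_upwards [hdet, hc.eventually (hu.eventually (by simp)),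
    hc.eventually (eventually_eventually_nhds.2 he)] with y hy1 hy2 hy3
  refine mem_of_isUnit_of_mem_closure hG ((Matrix.isUnit_iff_isUnit_det _).2 hy1.isUnit) ?_
  rw [jacobi, hd y hy2]
  refine toMatrix'_mem_closure (T := τ • B) (fun v => ?_) (u (y, τ)) _ fun w => ?_
  · exact (lieAlg G).smul_mem τ (hBG v)
  · refine (fderiv_slice_eq hB hy2 hy3 w).trans ?_
    congr 1
    ext1 s
    simp only [ContinuousMap.smul_apply, curveIntegralL_apply, ← intervalIntegral.integral_smul]
    rfl

/-- A quadratic vector field whose time one map is the identity germ vanishes. -/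
theorem eq_zero_of_timeOne_eq_id {E : Type*} [NormedAddCommGroup E] [NormedSpace ℝ E]
    [CompleteSpace E] {B : E →L[ℝ] E →L[ℝ] E} (hB : ∀ v w, B v w = B w v)
    {u : E × ℝ → C(I, E)} {τ : ℝ} (hτ : τ ≠ 0) (hu : ContDiffAt ℝ ω u (0, τ))
    (he : ∀ᶠ z in 𝓝 ((0 : E), τ),
      u z = constCurve _ z.1 + (z.2 / 2) • curveIntegralL B (u z) (u z))
    (h0 : u (0, τ) = 0) (hid : ∀ᶠ y in 𝓝 (0 : E), u (y, τ) 1 = y) : B = 0 := by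
  -- The integral term of `u (r • y, τ)` at time one vanishes for small `r`. It is quadratic in the
  -- curve, and `u (r • y, τ) / r` tends to the constant curve `y`, so dividing by `r²` leaves `B y
  -- y` in the limit. Polarization then gives `B = 0`.
  have diag : ∀ y, B y y = 0 := by
    intro y
    have hc : Filter.Tendsto (fun r : ℝ => r • y) (𝓝 0) (𝓝 0) := by
      simpa using (Continuous.tendsto (f := fun r : ℝ => r • y) (by fun_prop) 0)
    have hc' : Filter.Tendsto (fun x : E => (x, τ)) (𝓝 0) (𝓝 (0, τ)) :=
      Continuous.tendsto (by fun_prop) 0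
    have hg : HasDerivAt (fun r : ℝ => u (r • y, τ)) (constCurve E y) 0 := by
      have h1 : HasDerivAt (fun r : ℝ => r • y) y 0 := by
        simpa using (hasDerivAt_id (0 : ℝ)).smul_const y
      have h2 : HasFDerivAt (fun x => u (x, τ)) (fderiv ℝ u (0, τ) ∘L .inl ℝ E ℝ)
          ((0 : ℝ) • y) := by
        rw [zero_smul]
        exact hasFDerivAt_slice hu
      have h3 := h2.comp_hasDerivAt 0 h1
      have h4 := fderiv_slice_eq hB hu he y
      rw [h0, map_zero, _root_.zero_apply, smul_zero, add_zero] at h4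
      exact h3.congr_deriv h4
    have hs := hasDerivAt_iff_tendsto_slope.1 hg
    have hK : Continuous fun v : C(I, E) => curveIntegralL B v v 1 :=
      (ContinuousMap.evalCLM ℝ (1 : I) : C(I, E) →L[ℝ] E).continuous.comp
        ((curveIntegralL B).continuous.clm_apply continuous_id)
    have hlim := (hK.tendsto (constCurve E y)).comp hs
    have hval : curveIntegralL B (constCurve E y) (constCurve E y) 1 = B y y := by
      simp [curveIntegralL_apply]
    rw [hval] at hlim
    refine tendsto_nhds_unique (hlim.congr' ?_) tendsto_const_nhds
    filter_upwards [nhdsWithin_le_nhds (hc.eventually hid),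
      nhdsWithin_le_nhds (hc.eventually (hc'.eventually he))] with r hr1 hr2
    have h5 := congrArg (fun c : C(I, E) => c 1) hr2
    simp only [ContinuousMap.add_apply, ContinuousMap.smul_apply, constCurve_apply] at h5
    rw [hr1, left_eq_add, smul_eq_zero, or_iff_right (div_ne_zero hτ two_ne_zero)] at h5
    simp only [Function.comp_apply, slope_def_module, zero_smul, h0, sub_zero, map_smul,
      _root_.smul_apply, ContinuousMap.smul_apply, h5, smul_zero]
  ext v w
  have h := diag (v + w)
  simp only [map_add, _root_.add_apply, diag, hB w v, zero_add, add_zero] at h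
  rw [← two_smul ℝ, smul_eq_zero, or_iff_right two_ne_zero] at h
  exact h

/-- If `Diff₀[G](p) = G`, the first prolongation of `𝔤` is trivial. -/
theorem eq_zero_of_diffZeroEq (hG : IsClosed (G : Set (GL (Fin p) ℝ))) (h : DiffZeroEq G)
    {B : (Fin p → ℝ) →L[ℝ] (Fin p → ℝ) →L[ℝ] (Fin p → ℝ)} (hB : ∀ v w, B v w = B w v)
    (hBG : ∀ v, LinearMap.toMatrix' (B v : (Fin p → ℝ) →ₗ[ℝ] (Fin p → ℝ)) ∈ lieAlg G) : B = 0 := by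
  obtain ⟨u, hu, he, h0, hτ0⟩ := exists_integral_curves B
  have hall := ((hu.eventually (by simp)).and (eventually_eventually_nhds.2 he)).and
    ((continuous_snd.tendsto (0 : (Fin p → ℝ) × ℝ)).eventually h0)
  obtain ⟨ε, ε0, hε⟩ := Metric.eventually_nhds_iff_ball.1 hall
  -- Halving keeps `c * t` strictly inside the ball for all `t ∈ [0, 1]`, so `t ↦ c * t` turns the
  -- family into an isotopy starting at the identity.
  set c := ε / 2 with hc
  have c0 : 0 < c := half_pos ε0
  have hball : ∀ t ∈ Set.Icc (0 : ℝ) 1, ((0 : Fin p → ℝ), c * t) ∈ Metric.ball 0 ε := by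
    intro t ht
    rw [mem_ball_zero_iff, Prod.norm_mk, norm_zero, max_lt_iff, Real.norm_eq_abs,
      abs_of_nonneg (mul_nonneg c0.le ht.1)]
    exact ⟨ε0, by nlinarith [ht.2]⟩
  have hmem : ∀ t ∈ Set.Icc (0 : ℝ) 1, jacobi (fun y => u (y, c * t) 1) 0 = 1 ∧
      (Filter.Germ.ofFun (fun y => u (y, c * t) 1) : Germs p p) ∈ diffG G := fun t ht =>
    have ⟨⟨h1, h2⟩, h3⟩ := hε _ (hball t ht)
    timeOne_mem_diffG hG hB hBG h1 h2 h3
  have hone : (Filter.Germ.ofFun (fun y => u (y, c * 1) 1) : Germs p p) ∈ diffZero G := by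
    refine ⟨(hmem 1 (by simp)).2, fun z => u (z.1, c * z.2) 1, ?_, fun t ht => (hmem t ht).2, ?_,
      rfl⟩
    · have ho : IsOpen ((fun z : (Fin p → ℝ) × ℝ => (z.1, c * z.2)) ⁻¹' Metric.ball 0 ε) :=
        Metric.isOpen_ball.preimage (by fun_prop)
      refine Filter.eventually_of_mem (ho.mem_nhdsSet.2 ?_) fun z hz => ?_
      · rintro ⟨y, t⟩ ⟨rfl, ht⟩
        exact hball t ht
      · have h1 : ContDiffAt ℝ ∞ u (z.1, c * z.2) := (hε _ hz).1.1.of_le le_top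
        have h2 : ContDiffAt ℝ ∞ (fun z : (Fin p → ℝ) × ℝ => (z.1, c * z.2)) z :=
          ContDiff.contDiffAt (by fun_prop)
        exact (ContinuousMap.evalCLM ℝ (1 : I) : C(I, Fin p → ℝ) →L[ℝ] (Fin p → ℝ)).contDiff.contDiffAt.comp z
          (ContDiffAt.comp z h1 h2)
    · refine Filter.Germ.coe_eq.2 ?_
      filter_upwards [hτ0] with y hy
      simp only [mul_zero, hy, constCurve_apply]
  rw [h] at hone
  obtain ⟨A, -, hA⟩ := hone
  have hA' : (fun y => u (y, c * 1) 1) =ᶠ[𝓝 0] fun y => A.val *ᵥ y := Filter.Germ.coe_eq.1 hA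
  -- A linear germ is determined by its Jacobi matrix at `0`, here the identity.
  have hA1 : A.val = 1 := by
    rw [← jacobi_mulVec_eq A.val 0, ← jacobi_congr hA']
    exact (hmem 1 (by simp)).1
  have ⟨⟨h1, h2⟩, h3⟩ := hε _ (hball 1 (by simp))
  refine eq_zero_of_timeOne_eq_id hB (by simpa using c0.ne') h1 h2 h3 ?_
  filter_upwards [hA'] with y hy
  rw [hy, hA1, Matrix.one_mulVec]

/-- At each point near `0` the second derivative of `η` is symmetric with values in `𝔤`, so it
belongs to the first prolongation, which is trivial. -/
theorem thetaZero_le_of_diffZeroEq (hG : IsClosed (G : Set (GL (Fin p) ℝ))) (h : DiffZeroEq G) :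
    thetaZero G ≤ (lieAlg G).map (linearGerm p) := by
  refine thetaZero_le_of_fderiv_fderiv fun η hη hJ => ?_
  filter_upwards [hη, eventually_eventually_nhds.2 hJ] with y hy hJy
  refine eq_zero_of_diffZeroEq hG h (fun v w => ?_) (toMatrix'_fderiv_fderiv_mem hy hJy)
  exact (hy.isSymmSndFDerivAt (by simp; norm_cast)) v w

end

end GeometricEquivalence

theorem corollary7p3 (n p : ℕ) (G : Subgroup (GL (Fin p) ℝ))
    (hG : IsClosed (G : Set (GL (Fin p) ℝ)))
    (h : GeometricEquivalence.LieAlgIsoTheta G ∨ GeometricEquivalence.ThetaLinear G ∨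
      GeometricEquivalence.DiffZeroEq G)
    (f : GeometricEquivalence.MapGerm n p) :
    GeometricEquivalence.tangentRG G f ≤ GeometricEquivalence.tangentAG G f ∧
      Subsingleton (GeometricEquivalence.RelModuli G f) := by
  have e : GeometricEquivalence.tangentAG G f = GeometricEquivalence.tangentRG G f := by
    refine GeometricEquivalence.tangentAG_eq_tangentRG ?_ f
    rcases h with h | h | h
    · exact GeometricEquivalence.thetaZero_le_of_iso h
    · exact GeometricEquivalence.thetaZero_le_of_linear h
    · exact GeometricEquivalence.thetaZero_le_of_diffZeroEq hG h
  refine ⟨e.ge, Submodule.Quotient.subsingleton_iff.2 ?_⟩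
  exact Submodule.comap_subtype_eq_top.2 e.le
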